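/- Let $\mathrm{Li}_2(z)=-\int_0^1 \frac{\mathrm{Log}(1-tz)}{t}\,dt$ for $z\in\mathbb C\setminus[1,\infty)$ ($\mathrm{Log}$ the principal logarithm) be the dilogarithm, i.e. the analytic continuation of $\sum_{n\ge1} z^n/n^2$ from the unit disc. For every real $a>1$, the function $x\mapsto \frac{\mathrm{Li}_2(-x^a)+\mathrm{Li}_2(-x^{-a})}{1+x^a}$ is Lebesgue integrable on $(0,\infty)$, and $$\int_0^\infty \frac{\mathrm{Li}_2(-x^a)+\mathrm{Li}_2(-x^{-a})}{1+x^a}\,dx=\frac{\pi^3}{3a}\cdot\frac{\sin^2(\pi/a)-3}{\sin^3(\pi/a)}.$$ -/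

import Mathlib

/-- The principal branch of the dilogarithm, `Li₂(z) = -∫₀^z Log(1 - u) / u du`, integrated along
the straight segment `u = t z`, `0 ≤ t ≤ 1`. It is the analytic continuation of
`∑_{n ≥ 1} z ^ n / n ^ 2` from the open unit disc to `ℂ` slit along `[1, ∞)`. -/
noncomputable def dilog (z : ℂ) : ℂ :=
  -∫ t in (0 : ℝ)..1, Complex.log (1 - (t : ℂ) * z) / (t : ℂ)

/-! By the inversion formula `Li₂(-w) + Li₂(-w⁻¹) = -π² / 6 - (log w)² / 2`, the integrand at `x` is
`-(π² / 6 + (log t)² / 2) / (1 + t)` with `t = x ^ a`. Substituting `t` for `x` turns the integral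
into a combination of the Mellin transforms of `(1 + t)⁻¹` and `(log t)² (1 + t)⁻¹` at `s = 1 / a`.
The first is the beta integral `B(s, 1 - s) = π / sin (π s)`, and the second is the second
derivative of the first with respect to `s`. The inversion formula holds because the difference of
its two sides has zero derivative on the slit plane and vanishes at `w = 1`, as
`Li₂(-1) = -ζ(2) / 2`. -/

open Asymptotics Complex Filter MeasureTheory Set Topology
open scoped Real

theorem one_sub_ofReal_mul_mem_slitPlane {z : ℂ} (hz : 1 - z ∈ slitPlane) {t : ℝ}
    (ht : t ∈ Icc (0 : ℝ) 1) : 1 - t * z ∈ slitPlane := by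
  have h := starConvex_one_slitPlane.add_smul_mem (y := -z) (by simpa [← sub_eq_add_neg] using hz)
    ht.1 ht.2
  simpa [← sub_eq_add_neg] using h

theorem integral_pow_pred_Ioc {n : ℕ} (hn : n ≠ 0) :
    ∫ t in Ioc (0 : ℝ) 1, t ^ (n - 1) = (n : ℝ)⁻¹ := by
  obtain ⟨m, rfl⟩ := Nat.exists_eq_succ_of_ne_zero hn
  rw [← intervalIntegral.integral_of_le zero_le_one]
  simp

theorem hasSum_log_one_sub_mul_div {z : ℂ} (hz : ‖z‖ ≤ 1) {t : ℝ} (ht : t ∈ Ioo (0 : ℝ) 1) :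
    HasSum (fun n : ℕ => (z ^ n / n) * ((t ^ (n - 1) : ℝ) : ℂ)) (-(log (1 - t * z) / t)) := by
  have ht0 : (t : ℂ) ≠ 0 := ofReal_ne_zero.2 ht.1.ne'
  have hnorm : ‖t * z‖ < 1 := by
    rw [norm_mul, norm_real, Real.norm_of_nonneg ht.1.le]
    exact mul_lt_one_of_nonneg_of_lt_one_left ht.1.le ht.2 hz
  have hlog := (hasSum_taylorSeries_neg_log hnorm).div_const (t : ℂ)
  rw [neg_div] at hlog
  refine hlog.congr_fun fun n => ?_
  rcases n with _ | n
  · simp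
  · push_cast [Nat.add_sub_cancel]
    field_simp
    ring

-- The term with `n = 0` vanishes since it is a division by zero.
theorem hasSum_dilog {z : ℂ} (hz : ‖z‖ ≤ 1) :
    HasSum (fun n : ℕ => z ^ n / (n : ℂ) ^ 2) (dilog z) := by
  let F : ℕ → ℝ → ℂ := fun n t => (z ^ n / n) * ((t ^ (n - 1) : ℝ) : ℂ)
  have hF : ∀ n, Integrable (F n) (volume.restrict (Ioc 0 1)) := fun n =>
    (by fun_prop : Continuous (F n)).integrableOn_Icc.mono_set Ioc_subset_Icc_self
  have hF_integral : ∀ n, ∫ t in Ioc (0 : ℝ) 1, F n t = z ^ n / (n : ℂ) ^ 2 := fun n => by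
    rcases eq_or_ne n 0 with rfl | hn
    · simp [F]
    · rw [integral_const_mul, integral_complex_ofReal, integral_pow_pred_Ioc hn, ofReal_inv,
        ofReal_natCast, ← div_eq_mul_inv, div_div, sq]
  have hF_norm : ∀ n, ∫ t in Ioc (0 : ℝ) 1, ‖F n t‖ = ‖z‖ ^ n / (n : ℝ) ^ 2 := fun n => by
    rcases eq_or_ne n 0 with rfl | hn
    · simp [F]
    · have : ∀ t ∈ Ioc (0 : ℝ) 1, ‖F n t‖ = ‖z‖ ^ n / n * t ^ (n - 1) := fun t ht => by
        simp [F, abs_of_pos ht.1]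
      rw [setIntegral_congr_fun measurableSet_Ioc this, integral_const_mul,
        integral_pow_pred_Ioc hn, ← div_eq_mul_inv, div_div, sq]
  have hF_summable : Summable fun n => ∫ t in Ioc (0 : ℝ) 1, ‖F n t‖ := by
    simp only [hF_norm]
    refine hasSum_zeta_two.summable.of_nonneg_of_le (fun n => by positivity) fun n => ?_
    gcongr
    exact pow_le_one₀ (norm_nonneg z) hz
  have h := hasSum_integral_of_summable_integral_norm hF hF_summable
  simp only [hF_integral] at h
  rw [dilog, ← intervalIntegral.integral_neg, intervalIntegral.integral_of_le zero_le_one,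
    integral_Ioc_eq_integral_Ioo, setIntegral_congr_fun measurableSet_Ioo fun t ht =>
      (hasSum_log_one_sub_mul_div hz ht).tsum_eq.symm, ← integral_Ioc_eq_integral_Ioo]
  exact h

theorem dilog_one : dilog 1 = (π : ℂ) ^ 2 / 6 := by
  refine (hasSum_dilog norm_one.le).unique ?_
  simpa using hasSum_ofReal.2 hasSum_zeta_two

theorem dilog_add_dilog_neg {z : ℂ} (hz : ‖z‖ ≤ 1) :
    dilog z + dilog (-z) = dilog (z ^ 2) / 2 := by
  have hsq : ‖z ^ 2‖ ≤ 1 := norm_pow z 2 ▸ pow_le_one₀ (norm_nonneg z) hz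
  have hsum := (hasSum_dilog hz).add (hasSum_dilog (z := -z) (by rwa [norm_neg]))
  refine hsum.unique ?_
  rw [← add_zero (dilog (z ^ 2) / 2)]
  refine HasSum.even_add_odd (((hasSum_dilog hsq).div_const 2).congr_fun fun k => ?_)
    (hasSum_zero.congr_fun fun k => ?_)
  · rw [(even_two_mul k).neg_pow, pow_mul]
    push_cast
    ring
  · rw [(odd_two_mul_add_one k).neg_pow]
    ring

theorem dilog_neg_one : dilog (-1) = -((π : ℂ) ^ 2 / 12) := by
  have h := dilog_add_dilog_neg norm_one.le
  rw [one_pow, dilog_one] at h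
  linear_combination h

theorem intervalIntegrable_log_one_sub_mul_div {z : ℂ} (hz : 1 - z ∈ slitPlane) :
    IntervalIntegrable (fun t : ℝ => log (1 - t * z) / t) volume 0 1 := by
  let f : ℝ → ℂ := fun t => log (1 - t * z)
  have hf : ∀ t : ℝ, t ∈ Icc (0 : ℝ) 1 → DifferentiableAt ℝ f t := fun t ht =>
    (((hasDerivAt_id t).ofReal_comp.mul_const z).const_sub 1).clog_real
      (one_sub_ofReal_mul_mem_slitPlane hz ht) |>.differentiableAt
  have hslope : ContinuousOn (dslope f 0) (Icc 0 1) := fun t ht => by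
    rcases eq_or_ne t 0 with rfl | h0
    · exact (continuousAt_dslope_same.2 (hf 0 ht)).continuousWithinAt
    · exact ((continuousAt_dslope_of_ne h0).2 (hf t ht).continuousAt).continuousWithinAt
  refine (hslope.intervalIntegrable_of_Icc zero_le_one).congr fun t ht => ?_
  rw [uIoc_of_le zero_le_one] at ht
  rw [dslope_of_ne f ht.1.ne', slope_def_module]
  simp [f, div_eq_inv_mul]

theorem integral_inv_one_sub_mul {z : ℂ} (hz : 1 - z ∈ slitPlane) (h0 : z ≠ 0) :
    ∫ t in (0 : ℝ)..1, (1 - t * z)⁻¹ = -(log (1 - z) / z) := by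
  have h := log_inv_eq_integral hz
  rw [log_inv _ (slitPlane_arg_ne_pi hz)] at h
  rw [← neg_div, h, mul_div_cancel_left₀ _ h0]
  simp

theorem isOpen_one_sub_mem_slitPlane : IsOpen {z : ℂ | 1 - z ∈ slitPlane} :=
  isOpen_slitPlane.preimage (by fun_prop)

theorem continuousOn_inv_one_sub_mul :
    ContinuousOn (fun p : ℝ × ℂ => (1 - p.1 * p.2)⁻¹) (Icc 0 1 ×ˢ {z | 1 - z ∈ slitPlane}) :=
  ContinuousOn.inv₀ (by fun_prop) fun _ hp =>
    slitPlane_ne_zero (one_sub_ofReal_mul_mem_slitPlane hp.2 hp.1)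

theorem hasDerivAt_dilog {z : ℂ} (hz : 1 - z ∈ slitPlane) (h0 : z ≠ 0) :
    HasDerivAt dilog (-(log (1 - z) / z)) z := by
  obtain ⟨r, hr, hball⟩ := Metric.nhds_basis_closedBall.mem_iff.1
    (isOpen_one_sub_mem_slitPlane.mem_nhds hz)
  have hslit : ∀ t ∈ Ioc (0 : ℝ) 1, ∀ w ∈ Metric.closedBall z r, 1 - t * w ∈ slitPlane :=
    fun t ht w hw => one_sub_ofReal_mul_mem_slitPlane (hball hw) (Ioc_subset_Icc_self ht)
  obtain ⟨C, hC⟩ := (isCompact_Icc.prod (isCompact_closedBall z r)).exists_bound_of_continuousOn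
    (continuousOn_inv_one_sub_mul.mono (prod_mono_right hball))
  have h := (intervalIntegral.hasDerivAt_integral_of_dominated_loc_of_deriv_le
    (F := fun w t => log (1 - t * w) / t) (F' := fun w t => -(1 - t * w)⁻¹) (x₀ := z)
    (a := 0) (b := 1) (μ := volume) (bound := fun _ => C)
    (Metric.closedBall_mem_nhds z hr)
    (Eventually.of_forall fun w => (by fun_prop : Measurable _).aestronglyMeasurable)
    (intervalIntegrable_log_one_sub_mul_div hz)
    (by fun_prop : Measurable _).aestronglyMeasurable ?_ intervalIntegrable_const ?_).2.neg
  · rw [intervalIntegral.integral_neg, neg_neg, integral_inv_one_sub_mul hz h0] at h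
    exact h
  · refine ae_of_all _ fun t ht w hw => ?_
    rw [uIoc_of_le zero_le_one] at ht
    rw [norm_neg]
    exact hC (t, w) ⟨Ioc_subset_Icc_self ht, hw⟩
  · refine ae_of_all _ fun t ht w hw => ?_
    rw [uIoc_of_le zero_le_one] at ht
    have ht0 : (t : ℂ) ≠ 0 := ofReal_ne_zero.2 ht.1.ne'
    convert! ((((hasDerivAt_id w).const_mul (t : ℂ)).const_sub 1).clog
      (hslit t ht w hw)).div_const (t : ℂ) using 1
    simp only [mul_one, id]
    field_simp

theorem inv_mem_slitPlane {w : ℂ} (hw : w ∈ slitPlane) : w⁻¹ ∈ slitPlane := by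
  rw [mem_slitPlane_iff_arg] at hw ⊢
  refine ⟨?_, inv_ne_zero hw.2⟩
  rw [arg_inv, if_neg hw.1]
  linarith [neg_pi_lt_arg w]

theorem one_add_mem_slitPlane {w : ℂ} (hw : w ∈ slitPlane) : 1 + w ∈ slitPlane := by
  rw [mem_slitPlane_iff] at hw ⊢
  refine hw.imp (fun h => ?_) fun h => ?_
  · simpa using add_pos one_pos h
  · simpa using h

theorem eq_apply_one_of_hasDerivAt_zero_slitPlane {E : Type*} [NormedAddCommGroup E]
    [NormedSpace ℂ E] {f : ℂ → E} (hf : ∀ w ∈ slitPlane, HasDerivAt f 0 w) {w : ℂ}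
    (hw : w ∈ slitPlane) : f w = f 1 :=
  isOpen_slitPlane.is_const_of_deriv_eq_zero
    (starConvex_one_slitPlane.isPathConnected one_mem_slitPlane).isConnected.isPreconnected
    (fun z hz => (hf z hz).differentiableAt.differentiableWithinAt) (fun z hz => (hf z hz).deriv)
    hw one_mem_slitPlane

theorem log_one_add_inv {w : ℂ} (hw : w ∈ slitPlane) :
    log (1 + w⁻¹) = log (1 + w) - log w := by
  have hderiv : ∀ z ∈ slitPlane,
      HasDerivAt (fun z => log (1 + z) - log z - log (1 + z⁻¹)) 0 z := fun z hz => by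
    have hz0 : z ≠ 0 := slitPlane_ne_zero hz
    have hadd := one_add_mem_slitPlane hz
    have hadd0 : 1 + z ≠ 0 := slitPlane_ne_zero hadd
    have hadd_inv := one_add_mem_slitPlane (inv_mem_slitPlane hz)
    convert! ((((hasDerivAt_id z).const_add 1).clog hadd).sub (hasDerivAt_log hz)).sub
      (((hasDerivAt_inv hz0).const_add 1).clog hadd_inv) using 1
    rw [show 1 + z⁻¹ = (1 + z) / z by field_simp; ring, id]
    field_simp
    ring
  have hconst := eq_apply_one_of_hasDerivAt_zero_slitPlane hderiv hw
  simp only [inv_one, log_one, sub_zero, sub_self] at hconst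
  linear_combination -hconst

theorem dilog_neg_add_dilog_neg_inv {w : ℂ} (hw : w ∈ slitPlane) :
    dilog (-w) + dilog (-w⁻¹) = -((π : ℂ) ^ 2 / 6) - log w ^ 2 / 2 := by
  have hderiv : ∀ z ∈ slitPlane,
      HasDerivAt (fun z => dilog (-z) + dilog (-z⁻¹) + log z ^ 2 / 2) 0 z := fun z hz => by
    have hz0 : z ≠ 0 := slitPlane_ne_zero hz
    have hdilog : ∀ u ∈ slitPlane, HasDerivAt dilog (log (1 + u) / u) (-u) := fun u hu => by
      simpa [neg_div_neg_eq, div_neg] using hasDerivAt_dilog (z := -u)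
        (by simpa using one_add_mem_slitPlane hu) (neg_ne_zero.2 (slitPlane_ne_zero hu))
    convert! (((hdilog z hz).comp z (hasDerivAt_neg z)).add
      ((hdilog z⁻¹ (inv_mem_slitPlane hz)).comp z (hasDerivAt_inv hz0).neg)).add
      (((hasDerivAt_log hz).pow 2).div_const 2) using 1
    rw [log_one_add_inv hz]
    field_simp
    ring
  have hconst := eq_apply_one_of_hasDerivAt_zero_slitPlane hderiv hw
  simp only [inv_one, dilog_neg_one, log_one] at hconst
  linear_combination hconst

theorem dilog_neg_ofReal_add_dilog_neg_inv {t : ℝ} (ht : 0 < t) :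
    dilog ((-t : ℝ) : ℂ) + dilog ((-t⁻¹ : ℝ) : ℂ) =
      -((π : ℂ) ^ 2 / 6) - (Real.log t : ℂ) ^ 2 / 2 := by
  push_cast
  rw [dilog_neg_add_dilog_neg_inv (ofReal_mem_slitPlane.2 ht), ofReal_log ht.le]

theorem image_div_one_add_Ioi : (fun x : ℝ => x / (1 + x)) '' Ioi 0 = Ioo 0 1 := by
  ext t
  constructor
  · rintro ⟨x, hx : 0 < x, rfl⟩
    exact ⟨by positivity, (div_lt_one (by positivity)).2 (by linarith)⟩
  · rintro ⟨h0, h1⟩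
    have hsub : 0 < 1 - t := sub_pos.2 h1
    refine ⟨t / (1 - t), div_pos h0 hsub, ?_⟩
    field_simp
    ring

theorem injOn_div_one_add_Ioi : InjOn (fun x : ℝ => x / (1 + x)) (Ioi 0) := by
  intro x (hx : 0 < x) y (hy : 0 < y) hxy
  rw [div_eq_div_iff (by positivity) (by positivity)] at hxy
  linarith

theorem hasDerivAt_div_one_add {x : ℝ} (hx : 1 + x ≠ 0) :
    HasDerivAt (fun x : ℝ => x / (1 + x)) ((1 + x) ^ 2)⁻¹ x := by
  convert! (hasDerivAt_id x).div ((hasDerivAt_id x).const_add 1) hx using 1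
  simp

theorem beta_integrand_div_one_add (u v : ℂ) {x : ℝ} (hx : 0 < x) :
    |((1 + x) ^ 2)⁻¹| • (((x / (1 + x) : ℝ) : ℂ) ^ (u - 1) * (1 - (x / (1 + x) : ℝ)) ^ (v - 1)) =
      (x : ℂ) ^ (u - 1) * (1 + x : ℂ) ^ (-(u + v)) := by
  have hpos : 0 < 1 + x := by positivity
  have hne : ((1 + x : ℝ) : ℂ) ≠ 0 := ofReal_ne_zero.2 hpos.ne'
  have harg : arg ((1 + x : ℝ) : ℂ) ≠ π := by
    rw [arg_ofReal_of_nonneg hpos.le]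
    exact Real.pi_pos.ne
  have hsub : (1 : ℂ) - (x / (1 + x) : ℝ) = ((1 + x : ℝ) : ℂ)⁻¹ := by
    refine eq_inv_of_mul_eq_one_left ?_
    push_cast at hne ⊢
    field_simp
    ring
  have hcast : (1 + x : ℂ) = ((1 + x : ℝ) : ℂ) := by push_cast; rfl
  have hjac : ((|((1 + x) ^ 2)⁻¹| : ℝ) : ℂ) = ((1 + x : ℝ) : ℂ) ^ (-2 : ℂ) := by
    rw [abs_of_pos (by positivity), cpow_neg]
    norm_cast
  rw [hsub, ofReal_div, div_cpow_ofReal_nonneg hx.le hpos.le, inv_cpow _ _ harg, real_smul, hjac,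
    div_eq_mul_inv, ← cpow_neg, ← cpow_neg, mul_assoc, mul_left_comm, ← cpow_add _ _ hne,
    ← cpow_add _ _ hne, hcast]
  ring_nf

theorem betaIntegral_eq_mellin (u v : ℂ) :
    betaIntegral u v = mellin (fun t : ℝ => (1 + t : ℂ) ^ (-(u + v))) u := by
  rw [betaIntegral, intervalIntegral.integral_of_le zero_le_one, integral_Ioc_eq_integral_Ioo,
    ← image_div_one_add_Ioi, integral_image_eq_integral_abs_deriv_smul measurableSet_Ioi
      (fun x (hx : 0 < x) => (hasDerivAt_div_one_add (by positivity)).hasDerivWithinAt)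
      injOn_div_one_add_Ioi]
  exact setIntegral_congr_fun measurableSet_Ioi fun x hx => beta_integrand_div_one_add u v hx

theorem mellin_inv_one_add {s : ℂ} (h0 : 0 < s.re) (h1 : s.re < 1) :
    mellin (fun t : ℝ => (1 + t : ℂ)⁻¹) s = π / sin (π * s) := by
  have hbeta := Gamma_mul_Gamma_eq_betaIntegral (t := 1 - s) h0 (by simpa using h1)
  rw [betaIntegral_eq_mellin, add_sub_cancel, Complex.Gamma_one, one_mul,
    Complex.Gamma_mul_Gamma_one_sub] at hbeta
  simpa only [cpow_neg_one] using hbeta.symm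

theorem locallyIntegrableOn_log_smul {E : Type*} [NormedAddCommGroup E] [NormedSpace ℝ E]
    {f : ℝ → E} (hf : LocallyIntegrableOn f (Ioi 0)) :
    LocallyIntegrableOn (fun t => Real.log t • f t) (Ioi 0) :=
  hf.continuousOn_smul isOpen_Ioi.isLocallyClosed
    (Real.continuousOn_log.mono fun _ ht => (mem_Ioi.1 ht).ne')

section MellinTransform

variable {E : Type*} [NormedAddCommGroup E] [NormedSpace ℂ E] {a b : ℝ} {f : ℝ → E} {s : ℂ}

theorem hasMellin_of_eqOn {g : ℝ → E} {m : E} (hf : HasMellin f s m)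
    (hfg : EqOn g f (Ioi 0)) : HasMellin g s m := by
  have h : EqOn (fun t : ℝ => (t : ℂ) ^ (s - 1) • g t) (fun t => (t : ℂ) ^ (s - 1) • f t)
      (Ioi 0) := fun t ht => by simp only [hfg ht]
  exact ⟨hf.1.congr_fun h.symm measurableSet_Ioi,
    (setIntegral_congr_fun measurableSet_Ioi h).trans hf.2⟩

theorem hasDerivAt_mellin_log_pow_smul (n : ℕ) (hf : LocallyIntegrableOn f (Ioi 0))
    (hf_top : f =O[atTop] (· ^ (-a))) (hs_top : s.re < a)
    (hf_bot : f =O[𝓝[>] 0] (· ^ (-b))) (hs_bot : b < s.re) :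
    MellinConvergent (fun t => Real.log t ^ n • f t) s ∧
      HasDerivAt (mellin fun t => Real.log t ^ n • f t)
        (mellin (fun t => Real.log t ^ (n + 1) • f t) s) s := by
  induction n generalizing f a b with
  | zero =>
    simpa using And.intro (mellinConvergent_of_isBigO_rpow hf hf_top hs_top hf_bot hs_bot)
      (mellin_hasDerivAt_of_isBigO_rpow hf hf_top hs_top hf_bot hs_bot).2
  | succ n ih =>
    obtain ⟨a', hsa', ha'⟩ := exists_between hs_top
    obtain ⟨b', hb', hsb'⟩ := exists_between hs_bot
    simpa only [smul_smul, ← pow_succ] using ih (locallyIntegrableOn_log_smul hf)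
      (isBigO_rpow_top_log_smul ha' hf_top) hsa' (isBigO_rpow_zero_log_smul hb' hf_bot) hsb'

theorem iteratedDeriv_mellin (n : ℕ) (hf : LocallyIntegrableOn f (Ioi 0))
    (hf_top : f =O[atTop] (· ^ (-a))) (hs_top : s.re < a)
    (hf_bot : f =O[𝓝[>] 0] (· ^ (-b))) (hs_bot : b < s.re) :
    iteratedDeriv n (mellin f) s = mellin (fun t => Real.log t ^ n • f t) s := by
  induction n generalizing s with
  | zero => simp
  | succ n ih =>
    have hev : iteratedDeriv n (mellin f) =ᶠ[𝓝 s] mellin (fun t => Real.log t ^ n • f t) := by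
      filter_upwards [(isOpen_lt continuous_re continuous_const).mem_nhds hs_top,
        (isOpen_lt continuous_const continuous_re).mem_nhds hs_bot] with z hz_top hz_bot
      exact ih hz_top hz_bot
    rw [iteratedDeriv_succ, hev.deriv_eq]
    exact (hasDerivAt_mellin_log_pow_smul n hf hf_top hs_top hf_bot hs_bot).2.deriv

end MellinTransform

theorem hasDerivAt_inv_sin_const_mul (c : ℂ) {z : ℂ} (hz : sin (c * z) ≠ 0) :
    HasDerivAt (fun z => (sin (c * z))⁻¹) (-c * cos (c * z) / sin (c * z) ^ 2) z := by
  convert! ((hasDerivAt_id z).const_mul c).csin.inv hz using 1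
  simp only [id]
  ring

theorem iteratedDeriv_two_inv_sin_const_mul (c : ℂ) {z : ℂ} (hz : sin (c * z) ≠ 0) :
    iteratedDeriv 2 (fun z => (sin (c * z))⁻¹) z =
      c ^ 2 * (2 - sin (c * z) ^ 2) / sin (c * z) ^ 3 := by
  have hev : deriv (fun z => (sin (c * z))⁻¹) =ᶠ[𝓝 z]
      fun z => -c * cos (c * z) / sin (c * z) ^ 2 := by
    have hcont : ContinuousAt (fun z => sin (c * z)) z := by fun_prop
    filter_upwards [hcont.eventually_ne hz] with w hw
    exact (hasDerivAt_inv_sin_const_mul c hw).deriv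
  have hlin : HasDerivAt (fun z => c * z) c z := by simpa using (hasDerivAt_id z).const_mul c
  have hderiv : HasDerivAt (fun z => -c * cos (c * z) / sin (c * z) ^ 2)
      (c ^ 2 * (2 - sin (c * z) ^ 2) / sin (c * z) ^ 3) z := by
    convert! (hlin.ccos.const_mul (-c)).div (hlin.csin.pow 2) (pow_ne_zero 2 hz) using 1
    simp only [Pi.pow_apply]
    field_simp
    linear_combination -2 * c ^ 2 * sin (c * z) * cos_sq' (c * z)
  rw [iteratedDeriv_succ, iteratedDeriv_one, hev.deriv_eq, hderiv.deriv]

theorem locallyIntegrableOn_inv_one_add :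
    LocallyIntegrableOn (fun t : ℝ => (1 + t : ℂ)⁻¹) (Ioi 0) := by
  refine ContinuousOn.locallyIntegrableOn (ContinuousOn.inv₀ (by fun_prop) fun t ht => ?_)
    measurableSet_Ioi
  exact_mod_cast (add_pos one_pos ht).ne'

theorem norm_inv_one_add {t : ℝ} (ht : 0 < t) : ‖(1 + t : ℂ)⁻¹‖ = (1 + t)⁻¹ := by
  rw [norm_inv, ← ofReal_one, ← ofReal_add, norm_real, Real.norm_of_nonneg (by positivity)]

theorem isBigO_inv_one_add_atTop :
    (fun t : ℝ => (1 + t : ℂ)⁻¹) =O[atTop] (· ^ (-1 : ℝ) : ℝ → ℝ) := by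
  refine IsBigO.of_bound' ?_
  filter_upwards [eventually_gt_atTop 0] with t ht
  rw [norm_inv_one_add ht, Real.rpow_neg_one, Real.norm_of_nonneg (by positivity)]
  gcongr
  linarith

-- The exponent `-0` matches the bound `· ^ (-b)` in the lemmas on Mellin transforms.
theorem isBigO_inv_one_add_zero :
    (fun t : ℝ => (1 + t : ℂ)⁻¹) =O[𝓝[>] 0] (· ^ (-0 : ℝ) : ℝ → ℝ) := by
  refine IsBigO.of_bound' ?_
  filter_upwards [self_mem_nhdsWithin] with t (ht : 0 < t)
  rw [norm_inv_one_add ht, neg_zero, Real.rpow_zero, norm_one]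
  exact inv_le_one_of_one_le₀ (by linarith)

theorem mem_integerComplement_of_re_mem_Ioo {s : ℂ} (h0 : 0 < s.re) (h1 : s.re < 1) :
    s ∈ integerComplement := by
  rintro ⟨k, rfl⟩
  rw [intCast_re] at h0 h1
  norm_cast at h0 h1
  lia

theorem mellin_log_sq_smul_inv_one_add {s : ℂ} (h0 : 0 < s.re) (h1 : s.re < 1) :
    mellin (fun t : ℝ => Real.log t ^ 2 • (1 + t : ℂ)⁻¹) s =
      π ^ 3 * (2 - sin (π * s) ^ 2) / sin (π * s) ^ 3 := by
  have hev : mellin (fun t : ℝ => (1 + t : ℂ)⁻¹) =ᶠ[𝓝 s] fun z => π * (sin (π * z))⁻¹ := by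
    filter_upwards [(isOpen_lt continuous_const continuous_re).mem_nhds h0,
      (isOpen_lt continuous_re continuous_const).mem_nhds h1] with z hz0 hz1
    rw [mellin_inv_one_add hz0 hz1, div_eq_mul_inv]
  rw [← iteratedDeriv_mellin 2 locallyIntegrableOn_inv_one_add isBigO_inv_one_add_atTop h1
    isBigO_inv_one_add_zero h0, hev.iteratedDeriv_eq 2, iteratedDeriv_const_mul_field,
    iteratedDeriv_two_inv_sin_const_mul _
      (sin_pi_mul_ne_zero (mem_integerComplement_of_re_mem_Ioo h0 h1))]
  ring

theorem hasMellin_dilog_neg_add_dilog_neg_inv_div {s : ℂ} (h0 : 0 < s.re) (h1 : s.re < 1) :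
    HasMellin (fun t : ℝ => (dilog ((-t : ℝ) : ℂ) + dilog ((-t⁻¹ : ℝ) : ℂ)) / ((1 + t : ℝ) : ℂ)) s
      (π ^ 3 / 3 * ((sin (π * s) ^ 2 - 3) / sin (π * s) ^ 3)) := by
  have hsin := sin_pi_mul_ne_zero (mem_integerComplement_of_re_mem_Ioo h0 h1)
  have hconv (n : ℕ) : MellinConvergent (fun t : ℝ => Real.log t ^ n • (1 + t : ℂ)⁻¹) s :=
    (hasDerivAt_mellin_log_pow_smul n locallyIntegrableOn_inv_one_add isBigO_inv_one_add_atTop h1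
      isBigO_inv_one_add_zero h0).1
  have hconv_one : MellinConvergent (fun t : ℝ => (1 + t : ℂ)⁻¹) s := by simpa using hconv 0
  obtain ⟨hconst, hconst_eq⟩ := hasMellin_const_smul hconv_one (-((π : ℂ) ^ 2 / 6))
  obtain ⟨hlog, hlog_eq⟩ := hasMellin_const_smul (hconv 2) (1 / 2 : ℂ)
  have h := hasMellin_sub hconst hlog
  rw [hconst_eq, hlog_eq, mellin_inv_one_add h0 h1, mellin_log_sq_smul_inv_one_add h0 h1] at h
  convert! hasMellin_of_eqOn h fun t ht => ?_ using 1
  · simp only [smul_eq_mul]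
    field_simp
    ring
  · simp only [dilog_neg_ofReal_add_dilog_neg_inv ht, smul_eq_mul, real_smul]
    push_cast
    ring

theorem mainTheorem3 (a : ℝ) (ha : 1 < a) :
    MeasureTheory.IntegrableOn
      (fun x : ℝ =>
        (dilog ((-(x ^ a) : ℝ) : ℂ) + dilog ((-(x ^ (-a)) : ℝ) : ℂ)) / ((1 + x ^ a : ℝ) : ℂ))
      (Set.Ioi (0 : ℝ)) ∧
    ∫ x in Set.Ioi (0 : ℝ),
        (dilog ((-(x ^ a) : ℝ) : ℂ) + dilog ((-(x ^ (-a)) : ℝ) : ℂ)) / ((1 + x ^ a : ℝ) : ℂ) =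
      ((Real.pi ^ 3 / (3 * a) *
        ((Real.sin (Real.pi / a) ^ 2 - 3) / Real.sin (Real.pi / a) ^ 3) : ℝ) : ℂ) := by
  let g : ℝ → ℂ := fun t => (dilog ((-t : ℝ) : ℂ) + dilog ((-t⁻¹ : ℝ) : ℂ)) / ((1 + t : ℝ) : ℂ)
  have ha0 : 0 < a := one_pos.trans ha
  have hre : (1 / a : ℂ).re = 1 / a := by norm_cast
  obtain ⟨hg, hg_eq⟩ := hasMellin_dilog_neg_add_dilog_neg_inv_div (s := 1 / a)
    (by rw [hre]; positivity) (by rw [hre]; exact (div_lt_one ha0).2 ha)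
  have hint : EqOn (fun x : ℝ => (dilog ((-(x ^ a) : ℝ) : ℂ) + dilog ((-(x ^ (-a)) : ℝ) : ℂ)) /
      ((1 + x ^ a : ℝ) : ℂ)) (fun x => (x : ℂ) ^ ((1 : ℂ) - 1) • g (x ^ a)) (Ioi 0) :=
    fun x hx => by simp [g, Real.rpow_neg (mem_Ioi.1 hx).le]
  constructor
  · rw [integrableOn_congr_fun hint measurableSet_Ioi]
    exact (MellinConvergent.comp_rpow ha0.ne').2 hg
  · rw [setIntegral_congr_fun measurableSet_Ioi hint]
    change mellin (fun x => g (x ^ a)) 1 = _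
    rw [mellin_comp_rpow, hg_eq, abs_of_pos ha0, real_smul, mul_one_div]
    push_cast
    ring
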